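/- Let $(\mathcal V,\otimes,I,\sigma)$ be a braided monoidal category (it may be taken strict, and associativity and unit isomorphisms are suppressed below) which has coequalizers and equalizers, and in which $X\otimes-$ and $-\otimes X$ preserve coequalizers for every object $X$. Let $H=(H,e_H,m_H,\varepsilon_H,\delta_H,S)$ be a Hopf algebra in $\mathcal V$: $(H,e_H,m_H)$ is an algebra, $(H,\varepsilon_H,\delta_H)$ is a coalgebra, $\varepsilon_H$ and $\delta_H$ are algebra morphisms (where $H\otimes H$ has the multiplication $(m_H\otimes m_H)(H\otimes\sigma_{H,H}\otimes H)$ and the unit $e_H\otimes e_H$), and the antipode $S:H\to H$ satisfies $$m_H(H\otimes S)\delta_H=e_H\varepsilon_H=m_H(S\otimes H)\delta_H .$$ Let $\mathcal V^H_H$ be the category of Hopf modules over $H$. Its objects are triples $(M,\xi,\rho)$ where $(M,\xi:M\otimes H\to M)$ is a right $H$-module, $(M,\rho:M\to M\otimes H)$ is a right $H$-comodule, and $\rho$ is a morphism of right $H$-modules, that is, $$\rho\,\xi=(\xi\otimes m_H)(M\otimes\sigma_{H,H}\otimes H)(\rho\otimes\delta_H);$$ its morphisms are the morphisms of $\mathcal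 V$ that are both right $H$-module morphisms and right $H$-comodule morphisms. Then the functor $$\mathcal V\to\mathcal V^H_H,\qquad V\mapsto (V\otimes H,\;V\otimes m_H,\;V\otimes\delta_H),\qquad f\mapsto f\otimes H,$$ is an equivalence of categories. -/

import Mathlib

open CategoryTheory MonoidalCategory Limits
open scoped MonObj ComonObj

universe v u

namespace BraidedHopf

section RightModules

variable {V : Type u} [Category.{v} V] [MonoidalCategory V]

/-- `a : X ⊗ A ⟶ X` makes `X` a right module over the algebra (monoid object) `A`. -/
structure IsRightAction (A : V) [MonObj A] {X : V} (a : X ⊗ A ⟶ X) : Prop where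
  act_one : X ◁ η[A] ≫ a = (ρ_ X).hom
  act_act : a ▷ A ≫ a = (α_ X A A).hom ≫ X ◁ μ[A] ≫ a

/-- `c : X ⟶ X ⊗ C` makes `X` a right comodule over the coalgebra (comonoid object) `C`. -/
structure IsRightCoaction (C : V) [ComonObj C] {X : V} (c : X ⟶ X ⊗ C) : Prop where
  coact_counit : c ≫ X ◁ ε[C] = (ρ_ X).inv
  coact_coact : c ≫ c ▷ C ≫ (α_ X C C).hom = c ≫ X ◁ Δ[C]

/-- `f` is a morphism of right modules from `(X, a)` to `(Y, b)`. -/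
def IsActionHom {A X Y : V} (a : X ⊗ A ⟶ X) (b : Y ⊗ A ⟶ Y) (f : X ⟶ Y) : Prop :=
  a ≫ f = f ▷ A ≫ b

/-- `f` is a morphism of right comodules from `(X, c)` to `(Y, d)`. -/
def IsCoactionHom {C X Y : V} (c : X ⟶ X ⊗ C) (d : Y ⟶ Y ⊗ C) (f : X ⟶ Y) : Prop :=
  f ≫ d = c ≫ f ▷ C

end RightModules

variable {V : Type u} [Category.{v} V] [MonoidalCategory V] [BraidedCategory V]

/-- The right `H`-action on `X ⊗ H` induced by a right `H`-action `a` on `X`: with associators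
suppressed, it is
`X ⊗ H ⊗ H ⟶ X ⊗ H ⊗ H ⊗ H ⟶ X ⊗ H ⊗ H ⊗ H ⟶ X ⊗ H`, where the first map comultiplies the last
factor, the second one is the braiding of the two middle factors `H`, and the third one is
`a ⊗ μ`. -/
def tensorAction (H : V) [BimonObj H] {X : V} (a : X ⊗ H ⟶ X) : (X ⊗ H) ⊗ H ⟶ X ⊗ H :=
  (X ⊗ H) ◁ Δ[H] ≫ tensorμ X H H H ≫ (a ⊗ₘ μ[H])

/-- Right-right Hopf modules over a bialgebra `H` in a braided monoidal category: right modules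
and right comodules whose coaction is a morphism of right modules. -/
structure HopfModule (H : V) [BimonObj H] where
  /-- the underlying object -/
  X : V
  /-- the action -/
  act : X ⊗ H ⟶ X
  /-- the coaction -/
  coact : X ⟶ X ⊗ H
  isRightAction : IsRightAction H act
  isRightCoaction : IsRightCoaction H coact
  coact_hom : IsActionHom act (tensorAction H act) coact

/-- Morphisms of Hopf modules: morphisms of right modules and of right comodules. -/
@[ext]
structure HopfModule.Hom {H : V} [BimonObj H] (M N : HopfModule H) where
  /-- the underlying morphism -/
  hom : M.X ⟶ N.X
  isActionHom : IsActionHom M.act N.act hom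
  isCoactionHom : IsCoactionHom M.coact N.coact hom

/-- The category of Hopf modules, with the composition of the ambient category. -/
instance (H : V) [BimonObj H] : Category (HopfModule H) where
  Hom M N := HopfModule.Hom M N
  id M := ⟨𝟙 M.X, by simp [IsActionHom], by simp [IsCoactionHom]⟩
  comp {M N P} f g := ⟨f.hom ≫ g.hom, by
      have hf := f.isActionHom
      have hg := g.isActionHom
      unfold IsActionHom at *
      rw [← Category.assoc, hf, Category.assoc, hg, comp_whiskerRight, Category.assoc], by
      have hf := f.isCoactionHom
      have hg := g.isCoactionHom
      unfold IsCoactionHom at *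
      rw [Category.assoc, hg, ← Category.assoc, hf, comp_whiskerRight, Category.assoc]⟩
  id_comp f := HopfModule.Hom.ext (Category.id_comp f.hom)
  comp_id f := HopfModule.Hom.ext (Category.comp_id f.hom)
  assoc f g h := HopfModule.Hom.ext (Category.assoc f.hom g.hom h.hom)

/-- The Hopf module `Y ⊗ H`, with action `Y ⊗ μ` and coaction `Y ⊗ Δ`. -/
def freeHopfModule (H : V) [BimonObj H] (Y : V) : HopfModule H where
  X := Y ⊗ H
  act := (α_ Y H H).hom ≫ Y ◁ μ[H]
  coact := Y ◁ Δ[H] ≫ (α_ Y H H).inv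
  isRightAction := by
    constructor
    · have h : (Y ⊗ H) ◁ η[H] ≫ (α_ Y H H).hom = (α_ Y H (𝟙_ V)).hom ≫ Y ◁ H ◁ η[H] := by simp
      rw [← Category.assoc, h, Category.assoc, ← MonoidalCategory.whiskerLeft_comp]
      simp
    · simp only [comp_whiskerRight, whisker_assoc, Category.assoc, Iso.inv_hom_id_assoc,
        ← MonoidalCategory.whiskerLeft_comp, MonObj.mul_assoc]
      monoidal
  isRightCoaction := by
    constructor
    · have h : (α_ Y H H).inv ≫ (Y ⊗ H) ◁ ε[H] = Y ◁ H ◁ ε[H] ≫ (α_ Y H (𝟙_ V)).inv := by simp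
      rw [Category.assoc, h, ← MonoidalCategory.whiskerLeft_comp_assoc]
      simp
    · calc _ = Y ◁ (Δ[H] ≫ Δ[H] ▷ H ≫ (α_ H H H).hom) ≫ (α_ Y H (H ⊗ H)).inv := by monoidal
        _ = Y ◁ (Δ[H] ≫ H ◁ Δ[H]) ≫ (α_ Y H (H ⊗ H)).inv := by rw [ComonObj.comul_assoc]
        _ = _ := by monoidal
  coact_hom := by
    unfold IsActionHom tensorAction
    calc _ = (α_ Y H H).hom ≫ Y ◁ (μ[H] ≫ Δ[H]) ≫ (α_ Y H H).inv := by monoidal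
      _ = _ := by
        rw [BimonObj.mul_comul]
        simp only [tensorμ, MonoidalCategory.tensorHom_def]
        monoidal

/-- The functor `Y ↦ Y ⊗ H`, `f ↦ f ⊗ H` to Hopf modules. -/
def freeHopfModuleFunctor (H : V) [BimonObj H] : V ⥤ HopfModule H where
  obj Y := freeHopfModule H Y
  map {Y Z} f := ⟨f ▷ H, by
      simp [IsActionHom, freeHopfModule, whisker_exchange], by
      change f ▷ H ≫ Z ◁ Δ[H] ≫ (α_ Z H H).inv = (Y ◁ Δ[H] ≫ (α_ Y H H).inv) ≫ f ▷ H ▷ H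
      rw [← whisker_exchange_assoc]
      simp⟩
  map_id Y := HopfModule.Hom.ext (id_whiskerRight Y H)
  map_comp f g := HopfModule.Hom.ext (comp_whiskerRight f g H)

end BraidedHopf

namespace BraidedHopf

open BraidedCategory
open scoped HopfObj

variable {V : Type u} [Category.{v} V] [MonoidalCategory V] [BraidedCategory V]

/-! This is the fundamental theorem of Hopf modules. A morphism `Y ⊗ H ⟶ Z ⊗ H` is determined by its
restriction to `Y ⊗ 1`. That restriction is coinvariant, and coinvariants of `Z ⊗ H` lie in `Z ⊗ 1`
(`factor_unit`), so the functor is full and faithful. For essential surjectivity, `coinvProj` is an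
idempotent on `M` whose image is the coinvariants `W`. The map `w ⊗ h ↦ w h` from `W ⊗ H` to `M`
then has inverse `m ↦ p(m₀) ⊗ m₁`, where `p : M ⟶ W` is the projection. -/

/-- The morphism `h ⊗ (k ⊗ l) ↦ k ⊗ h l`, where `h` is braided past `k`. -/
def braidMul (H : V) [MonObj H] : H ⊗ (H ⊗ H) ⟶ H ⊗ H :=
  (α_ H H H).inv ≫ (β_ H H).hom ▷ H ≫ (α_ H H H).hom ≫ H ◁ μ[H]

/-- Up to braidings, `S(h₃) ⊗ h₁ S(h₂) = S(h) ⊗ 1`, since `S` reverses comultiplication. -/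
theorem comul_antipode_braidMul (H : V) [HopfObj H] :
    Δ[H] ≫ H ◁ (𝒮[H] ≫ Δ[H]) ≫ braidMul H = 𝒮[H] ≫ (ρ_ H).inv ≫ H ◁ η[H] := by
  -- Naturality of the braiding moves one antipode next to `μ` and the other to the end.
  have h1 : H ◁ H ◁ 𝒮[H] ≫ H ◁ 𝒮[H] ▷ H ≫ braidMul H =
      (α_ H H H).inv ≫ (β_ H H).hom ▷ H ≫ (α_ H H H).hom ≫ H ◁ (H ◁ 𝒮[H] ≫ μ[H]) ≫
        𝒮[H] ▷ H := by
    unfold braidMul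
    rw [associator_inv_naturality_middle_assoc, ← comp_whiskerRight_assoc,
      braiding_naturality_right, comp_whiskerRight_assoc, associator_naturality_left_assoc,
      ← whisker_exchange, associator_inv_naturality_right_assoc, whisker_exchange_assoc,
      associator_naturality_right_assoc, MonoidalCategory.whiskerLeft_comp_assoc]
  have h2 : H ◁ (β_ H H).hom ≫ (α_ H H H).inv ≫ (β_ H H).hom ▷ H =
      (α_ H H H).inv ≫ (β_ (H ⊗ H) H).hom ≫ (α_ H H H).inv := (hexagon_reverse H H H).symm
  have h3 : Δ[H] ≫ H ◁ Δ[H] ≫ (α_ H H H).inv = Δ[H] ≫ Δ[H] ▷ H := by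
    rw [← Category.assoc, ComonObj.comul_assoc]
    simp only [Category.assoc, Iso.hom_inv_id, Category.comp_id]
  have h4 : Δ[H] ▷ H ≫ (β_ (H ⊗ H) H).hom ≫ H ◁ (H ◁ 𝒮[H] ≫ μ[H]) =
      ε[H] ▷ H ≫ (β_ (𝟙_ V) H).hom ≫ H ◁ η[H] := by
    rw [← braiding_naturality_left, ← comp_whiskerRight_assoc, HopfObj.antipode_right,
      comp_whiskerRight_assoc, braiding_naturality_left]
  calc _ = Δ[H] ≫ H ◁ Δ[H] ≫ H ◁ (β_ H H).hom ≫
        H ◁ H ◁ 𝒮[H] ≫ H ◁ 𝒮[H] ▷ H ≫ braidMul H := by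
        rw [HopfObj.antipode_comul, tensorHom_def']
        simp only [MonoidalCategory.whiskerLeft_comp, Category.assoc]
    _ = (Δ[H] ≫ H ◁ Δ[H] ≫ (α_ H H H).inv) ≫ (β_ (H ⊗ H) H).hom ≫
        H ◁ (H ◁ 𝒮[H] ≫ μ[H]) ≫ 𝒮[H] ▷ H := by
        rw [h1, reassoc_of% h2]; simp
    _ = Δ[H] ≫ ε[H] ▷ H ≫ (β_ (𝟙_ V) H).hom ≫ H ◁ η[H] ≫ 𝒮[H] ▷ H := by
        rw [h3, Category.assoc, reassoc_of% h4]
    _ = _ := by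
        rw [ComonObj.counit_comul_assoc, braiding_tensorUnit_left, whisker_exchange]
        simp

theorem one_comul_braidMul (H : V) [BimonObj H] :
    η[H] ▷ H ≫ H ◁ Δ[H] ≫ braidMul H = (λ_ H).hom ≫ Δ[H] := by
  unfold braidMul
  rw [← whisker_exchange_assoc, associator_inv_naturality_left_assoc,
    ← comp_whiskerRight_assoc, braiding_naturality_left, comp_whiskerRight_assoc,
    associator_naturality_middle_assoc, ← MonoidalCategory.whiskerLeft_comp, MonObj.one_mul,
    braiding_tensorUnit_left]
  simp

/-- Isolates the part of the diagonal action that lives on `H` alone, so that the two preceding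
identities apply to any Hopf module. -/
theorem comp_tensorAction {H : V} [BimonObj H] {X W : V} (a : X ⊗ H ⟶ X) (t : W ⟶ H) :
    (X ⊗ H) ◁ t ≫ tensorAction H a =
      (α_ X H W).hom ≫ X ◁ (H ◁ (t ≫ Δ[H]) ≫ braidMul H) ≫ (α_ X H H).inv ≫ a ▷ H := by
  unfold tensorAction tensorμ braidMul
  rw [tensorHom_def']
  simp

namespace HopfModule

/-- A morphism into a Hopf module is coinvariant if the coaction sends `f` to `f ⊗ 1`. -/
def IsCoinvariant {H : V} [BimonObj H] (M : HopfModule H) {W : V} (f : W ⟶ M.X) : Prop :=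
  f ≫ M.coact = f ≫ (ρ_ M.X).inv ≫ M.X ◁ η[H]

theorem IsCoinvariant.coaction {H : V} [BimonObj H] {M : HopfModule H} {W : V} {f : W ⟶ M.X}
    (hf : M.IsCoinvariant f) :
    (f ▷ H ≫ M.act) ≫ M.coact = (W ◁ Δ[H] ≫ (α_ W H H).inv) ≫ (f ▷ H ≫ M.act) ▷ H := by
  have hc : M.act ≫ M.coact = M.coact ▷ H ≫ tensorAction H M.act := M.coact_hom
  have ht := comp_tensorAction M.act (𝟙 H)
  rw [MonoidalCategory.whiskerLeft_id, Category.id_comp, Category.id_comp] at ht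
  calc _ = (f ≫ M.coact) ▷ H ≫ tensorAction H M.act := by simp [hc]
    _ = f ▷ H ≫ (ρ_ M.X).inv ▷ H ≫ (α_ M.X (𝟙_ V) H).hom ≫
        M.X ◁ (η[H] ▷ H ≫ H ◁ Δ[H] ≫ braidMul H) ≫ (α_ M.X H H).inv ≫ M.act ▷ H := by
        rw [hf, ht]; simp
    _ = _ := by
        rw [one_comul_braidMul, comp_whiskerRight, Category.assoc,
          ← associator_inv_naturality_left_assoc, whisker_exchange_assoc]
        simp

/-- The Hopf module morphism `W ⊗ H ⟶ M` extending a coinvariant morphism `W ⟶ M`. -/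
def extend {H : V} [BimonObj H] (M : HopfModule H) {W : V} (f : W ⟶ M.X)
    (hf : M.IsCoinvariant f) : freeHopfModule H W ⟶ M where
  hom := f ▷ H ≫ M.act
  isActionHom := by
    change ((α_ W H H).hom ≫ W ◁ μ[H]) ≫ f ▷ H ≫ M.act = (f ▷ H ≫ M.act) ▷ H ≫ M.act
    rw [comp_whiskerRight_assoc, M.isRightAction.act_act, Category.assoc,
      whisker_exchange_assoc, associator_naturality_left_assoc]
  isCoactionHom := hf.coaction

/-- The endomorphism `m ↦ m₀ S(m₁)` projecting a Hopf module onto its coinvariants. -/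
def coinvProj {H : V} [HopfObj H] (M : HopfModule H) : M.X ⟶ M.X :=
  M.coact ≫ M.X ◁ 𝒮[H] ≫ M.act

variable {H : V} [HopfObj H] (M : HopfModule H)

theorem isCoinvariant_coinvProj : M.IsCoinvariant M.coinvProj := by
  have hc : M.act ≫ M.coact = M.coact ▷ H ≫ tensorAction H M.act := M.coact_hom
  unfold IsCoinvariant coinvProj
  calc _ = (M.coact ≫ M.coact ▷ H ≫ (α_ M.X H H).hom) ≫
        M.X ◁ (H ◁ (𝒮[H] ≫ Δ[H]) ≫ braidMul H) ≫ (α_ M.X H H).inv ≫ M.act ▷ H := by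
        simp only [Category.assoc]
        rw [hc, whisker_exchange_assoc, comp_tensorAction]
    _ = M.coact ≫ M.X ◁ (𝒮[H] ≫ (ρ_ H).inv ≫ H ◁ η[H]) ≫ (α_ M.X H H).inv ≫ M.act ▷ H := by
        rw [M.isRightCoaction.coact_coact, Category.assoc,
          ← MonoidalCategory.whiskerLeft_comp_assoc, comul_antipode_braidMul]
    _ = _ := by
        simp only [MonoidalCategory.whiskerLeft_comp, Category.assoc]
        rw [associator_inv_naturality_right_assoc, whisker_exchange]
        simp

variable {M}

theorem IsCoinvariant.comp_coinvProj {W : V} {f : W ⟶ M.X} (hf : M.IsCoinvariant f) :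
    f ≫ M.coinvProj = f := by
  unfold coinvProj
  rw [reassoc_of% hf, ← MonoidalCategory.whiskerLeft_comp_assoc, HopfObj.one_antipode,
    M.isRightAction.act_one]
  simp

/-- The coaction sends `f(w) h` to `f(w) h₁ ⊗ h₂`, and `h₁ S(h₂)` collapses to `ε(h)`. -/
theorem IsCoinvariant.act_coinvProj {W : V} {f : W ⟶ M.X} (hf : M.IsCoinvariant f) :
    f ▷ H ≫ M.act ≫ M.coinvProj = W ◁ ε[H] ≫ (ρ_ W).hom ≫ f := by
  have h := hf.coaction
  unfold coinvProj
  calc _ = ((f ▷ H ≫ M.act) ≫ M.coact) ≫ M.X ◁ 𝒮[H] ≫ M.act := by simp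
    _ = W ◁ (Δ[H] ≫ H ◁ 𝒮[H] ≫ μ[H]) ≫ f ▷ H ≫ M.act := by
        rw [h]
        simp only [comp_whiskerRight, Category.assoc]
        rw [← whisker_exchange_assoc, M.isRightAction.act_act, associator_naturality_right_assoc,
          associator_naturality_left_assoc, Iso.inv_hom_id_assoc]
        simp only [MonoidalCategory.whiskerLeft_comp, Category.assoc, whisker_exchange_assoc]
    _ = _ := by
        rw [HopfObj.antipode_right, MonoidalCategory.whiskerLeft_comp_assoc,
          whisker_exchange_assoc, M.isRightAction.act_one, rightUnitor_naturality]

variable (M)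

/-- This is `m₀ S(m₁) m₂ = m`, one of the two inverse laws for `W ⊗ H ≅ M`. -/
theorem coact_coinvProj_act : M.coact ≫ M.coinvProj ▷ H ≫ M.act = 𝟙 M.X := by
  unfold coinvProj
  calc _ = (M.coact ≫ M.coact ▷ H ≫ (α_ M.X H H).hom) ≫ M.X ◁ (𝒮[H] ▷ H ≫ μ[H]) ≫ M.act := by
        simp [M.isRightAction.act_act]
    _ = M.coact ≫ M.X ◁ (Δ[H] ≫ 𝒮[H] ▷ H ≫ μ[H]) ≫ M.act := by
        rw [M.isRightCoaction.coact_coact]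
        simp only [MonoidalCategory.whiskerLeft_comp, Category.assoc]
    _ = _ := by
        rw [HopfObj.antipode_left, MonoidalCategory.whiskerLeft_comp_assoc,
          M.isRightAction.act_one, ← Category.assoc, M.isRightCoaction.coact_counit]
        simp

theorem exists_coinvProj_splitting [HasEqualizers V] :
    ∃ (W : V) (i : W ⟶ M.X) (p : M.X ⟶ W), M.IsCoinvariant i ∧ i ≫ p = 𝟙 W ∧
      p ≫ i = M.coinvProj := by
  have hE : M.coinvProj ≫ M.coact = M.coinvProj ≫ (ρ_ M.X).inv ≫ M.X ◁ η[H] :=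
    M.isCoinvariant_coinvProj
  have hi : M.IsCoinvariant (equalizer.ι M.coact ((ρ_ M.X).inv ≫ M.X ◁ η[H])) :=
    equalizer.condition _ _
  -- `W` is the equalizer of the coaction and `m ↦ m ⊗ 1`.
  refine ⟨_, _, equalizer.lift M.coinvProj hE, hi, ?_, equalizer.lift_ι _ _⟩
  apply equalizer.hom_ext
  rw [Category.assoc, equalizer.lift_ι, hi.comp_coinvProj, Category.id_comp]

/-- A Hopf module morphism with invertible underlying morphism is an isomorphism. -/
theorem isIso_of_inverse {M N : HopfModule H} (f : M ⟶ N) (g : N.X ⟶ M.X)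
    (h₁ : HopfModule.Hom.hom f ≫ g = 𝟙 M.X) (h₂ : g ≫ HopfModule.Hom.hom f = 𝟙 N.X) :
    IsIso f := by
  have ha : M.act ≫ HopfModule.Hom.hom f = HopfModule.Hom.hom f ▷ H ≫ N.act :=
    HopfModule.Hom.isActionHom f
  have hc : HopfModule.Hom.hom f ≫ N.coact = M.coact ≫ HopfModule.Hom.hom f ▷ H :=
    HopfModule.Hom.isCoactionHom f
  have h₁' : HopfModule.Hom.hom f ▷ H ≫ g ▷ H = 𝟙 _ := by
    rw [← comp_whiskerRight, h₁, id_whiskerRight]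
  have h₂' : g ▷ H ≫ HopfModule.Hom.hom f ▷ H = 𝟙 _ := by
    rw [← comp_whiskerRight, h₂, id_whiskerRight]
  refine ⟨⟨g, ?_, ?_⟩, HopfModule.Hom.ext h₁, HopfModule.Hom.ext h₂⟩
  · calc N.act ≫ g = (g ▷ H ≫ HopfModule.Hom.hom f ▷ H) ≫ N.act ≫ g := by
          rw [h₂', Category.id_comp]
      _ = g ▷ H ≫ M.act := by
          rw [Category.assoc, ← reassoc_of% ha, h₁, Category.comp_id]
  · calc g ≫ M.coact = g ≫ M.coact ≫ HopfModule.Hom.hom f ▷ H ≫ g ▷ H := by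
          rw [h₁', Category.comp_id]
      _ = N.coact ≫ g ▷ H := by
          rw [← reassoc_of% hc, reassoc_of% h₂]

theorem exists_iso_freeHopfModule [HasEqualizers V] :
    ∃ W : V, Nonempty (freeHopfModule H W ≅ M) := by
  obtain ⟨W, i, p, hi, hip, hpi⟩ := M.exists_coinvProj_splitting
  have hp : i ▷ H ≫ M.act ≫ p = W ◁ ε[H] ≫ (ρ_ W).hom := by
    have h := hi.act_coinvProj
    have h' := congrArg (· ≫ p) h
    simpa [← hpi, hip] using h'
  have : IsIso (M.extend i hi) := by
    refine isIso_of_inverse _ (M.coact ≫ p ▷ H) ?_ ?_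
    · change (i ▷ H ≫ M.act) ≫ M.coact ≫ p ▷ H = 𝟙 (W ⊗ H)
      rw [← Category.assoc, hi.coaction, Category.assoc, ← comp_whiskerRight, Category.assoc,
        Category.assoc, hp]
      have h : W ◁ (Δ[H] ≫ ε[H] ▷ H) = W ◁ (λ_ H).inv := by rw [ComonObj.counit_comul]
      rw [MonoidalCategory.whiskerLeft_comp] at h
      simp [reassoc_of% h]
    · change (M.coact ≫ p ▷ H) ≫ i ▷ H ≫ M.act = 𝟙 M.X
      rw [Category.assoc, ← comp_whiskerRight_assoc, hpi, M.coact_coinvProj_act]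
  exact ⟨W, ⟨asIso (M.extend i hi)⟩⟩

end HopfModule

theorem isCoinvariant_unit (H : V) [BimonObj H] (Y : V) :
    (freeHopfModule H Y).IsCoinvariant ((ρ_ Y).inv ≫ Y ◁ η[H]) := by
  change ((ρ_ Y).inv ≫ Y ◁ η[H]) ≫ Y ◁ Δ[H] ≫ (α_ Y H H).inv =
    ((ρ_ Y).inv ≫ Y ◁ η[H]) ≫ (ρ_ (Y ⊗ H)).inv ≫ (Y ⊗ H) ◁ η[H]
  rw [Category.assoc, ← MonoidalCategory.whiskerLeft_comp_assoc, Bimon.one_comul,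
    MonoidalCategory.tensorHom_def]
  simp only [MonoidalCategory.whiskerLeft_comp, Category.assoc]
  monoidal

theorem HopfModule.IsCoinvariant.comp {H : V} [BimonObj H] {M N : HopfModule H} {W : V}
    {f : W ⟶ M.X} (hf : M.IsCoinvariant f) (g : M ⟶ N) :
    N.IsCoinvariant (f ≫ HopfModule.Hom.hom g) := by
  have hc : HopfModule.Hom.hom g ≫ N.coact = M.coact ≫ HopfModule.Hom.hom g ▷ H :=
    HopfModule.Hom.isCoactionHom g
  unfold HopfModule.IsCoinvariant
  rw [Category.assoc, hc, reassoc_of% hf, whisker_exchange]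
  simp

/-- Coinvariant morphisms into `Z ⊗ H` factor through `Z`. -/
theorem HopfModule.IsCoinvariant.factor_unit {H : V} [BimonObj H] {W Z : V}
    {f : W ⟶ Z ⊗ H} (hf : (freeHopfModule H Z).IsCoinvariant f) :
    f = (f ≫ Z ◁ ε[H] ≫ (ρ_ Z).hom) ≫ (ρ_ Z).inv ≫ Z ◁ η[H] := by
  have hf' : f ≫ Z ◁ Δ[H] ≫ (α_ Z H H).inv = f ≫ (ρ_ (Z ⊗ H)).inv ≫ (Z ⊗ H) ◁ η[H] := hf
  -- Applying `ε` to the middle factor of `z ⊗ h₁ ⊗ h₂ = z ⊗ h ⊗ 1` gives `z ⊗ h = z ⊗ ε(h) 1`.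
  have h := congrArg (· ≫ (α_ Z H H).hom ≫ Z ◁ (ε[H] ▷ H ≫ (λ_ H).hom)) hf'
  have h' : Z ◁ Δ[H] ≫ Z ◁ ε[H] ▷ H = Z ◁ (λ_ H).inv := by
    rw [← MonoidalCategory.whiskerLeft_comp, ComonObj.counit_comul]
  have h2 : Z ◁ H ◁ η[H] ≫ Z ◁ ε[H] ▷ H ≫ Z ◁ (λ_ H).hom =
      Z ◁ (ρ_ H).hom ≫ Z ◁ ε[H] ≫ Z ◁ η[H] := by
    simp only [← MonoidalCategory.whiskerLeft_comp]
    rw [whisker_exchange_assoc, leftUnitor_naturality, unitors_equal,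
      rightUnitor_naturality_assoc]
  simp only [MonoidalCategory.whiskerLeft_comp, Category.assoc, Iso.inv_hom_id_assoc,
    reassoc_of% h', whiskerLeft_inv_hom, Category.comp_id, tensor_whiskerLeft, h2] at h
  simpa using h

/-- A module morphism from a free module is determined by its restriction to the unit. -/
theorem actionHom_eq {H : V} [BimonObj H] {X Y : V} {a : X ⊗ H ⟶ X} {g : Y ⊗ H ⟶ X}
    (hg : IsActionHom ((α_ Y H H).hom ≫ Y ◁ μ[H]) a g) :
    g = (((ρ_ Y).inv ≫ Y ◁ η[H]) ≫ g) ▷ H ≫ a := by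
  unfold IsActionHom at hg
  have h : Y ◁ η[H] ▷ H ≫ Y ◁ μ[H] = Y ◁ (λ_ H).hom := by
    rw [← MonoidalCategory.whiskerLeft_comp, MonObj.one_mul]
  simp only [comp_whiskerRight, Category.assoc]
  rw [← hg]
  simp [reassoc_of% h]

instance (H : V) [BimonObj H] : (freeHopfModuleFunctor H).Faithful where
  map_injective {Y Z} f g h := by
    have h' : f ▷ H = g ▷ H := congrArg HopfModule.Hom.hom h
    have key (k : Y ⟶ Z) : k = ((ρ_ Y).inv ≫ Y ◁ η[H]) ≫ k ▷ H ≫ Z ◁ ε[H] ≫ (ρ_ Z).hom := by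
      rw [Category.assoc, whisker_exchange_assoc, ← MonoidalCategory.whiskerLeft_comp_assoc]
      simp
    rw [key f, key g, h']

instance (H : V) [BimonObj H] : (freeHopfModuleFunctor H).Full where
  map_surjective {Y Z} g := by
    let g' : Y ⊗ H ⟶ Z ⊗ H := HopfModule.Hom.hom g
    -- On `Y ⊗ 1`, `g` has the form `y ↦ k(y) ⊗ 1`; `H`-linearity then forces `g = k ⊗ H`.
    have hu : ((ρ_ Y).inv ≫ Y ◁ η[H]) ≫ g' =
        ((((ρ_ Y).inv ≫ Y ◁ η[H]) ≫ g') ≫ Z ◁ ε[H] ≫ (ρ_ Z).hom) ≫ (ρ_ Z).inv ≫ Z ◁ η[H] :=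
      ((isCoinvariant_unit H Y).comp g).factor_unit
    have hg : g' = (((ρ_ Y).inv ≫ Y ◁ η[H]) ≫ g') ▷ H ≫ (α_ Z H H).hom ≫ Z ◁ μ[H] :=
      actionHom_eq (HopfModule.Hom.isActionHom g)
    have h : Z ◁ η[H] ▷ H ≫ Z ◁ μ[H] = Z ◁ (λ_ H).hom := by
      rw [← MonoidalCategory.whiskerLeft_comp, MonObj.one_mul]
    have hunit (k : Y ⟶ Z) :
        (k ≫ (ρ_ Z).inv ≫ Z ◁ η[H]) ▷ H ≫ (α_ Z H H).hom ≫ Z ◁ μ[H] = k ▷ H := by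
      simp [h]
    rw [hu, hunit] at hg
    exact ⟨_, HopfModule.Hom.ext hg.symm⟩

instance (H : V) [HopfObj H] [HasEqualizers V] : (freeHopfModuleFunctor H).EssSurj where
  mem_essImage M := M.exists_iso_freeHopfModule

end BraidedHopf

theorem theorem5p18 {V : Type u} [Category.{v} V] [MonoidalCategory V] [BraidedCategory V]
    [HasCoequalizers V] [HasEqualizers V]
    [∀ X : V, PreservesColimitsOfShape WalkingParallelPair (tensorLeft X)]
    [∀ X : V, PreservesColimitsOfShape WalkingParallelPair (tensorRight X)]
    (H : V) [HopfObj H] :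
    (BraidedHopf.freeHopfModuleFunctor H).IsEquivalence where
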